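/- Let $d\ge 1$, let $\mathcal C$ be a symmetric positive definite $d\times d$ matrix, and let $\gamma^{\mathcal C}=\mathcal N(0,\mathcal C)$ be the centered Gaussian measure on $\mathbb R^d$ with its density $\gamma^{\mathcal C}(x)=(2\pi)^{-d/2}(\det\mathcal C)^{-1/2}e^{-x\cdot\mathcal C^{-1}x/2}$. Let $M$ and $m$ be the largest and smallest eigenvalues of $\mathcal C^{-1}$, let $\kappa=M/m$, and let $|x|_{\mathcal C^{-1/2}}=|\mathcal C^{-1/2}x|$. For $x\in\mathbb R^d$, let $\pi_{\mathrm{H\&R}}(x,\cdot)$ be the Hit-and-Run transition distribution with target $\gamma^{\mathcal C}$: \[ \pi_{\mathrm{H\&R}}(x,A)=\int_{\mathbb S^{d-1}}\int_{\mathbb R}1_A(x+hv)\,\gamma^{\mathcal C}_{x,v}(dh)\,\sigma_{d-1}(dv), \] where $\sigma_{d-1}$ is the uniform distribution on the unit sphere $\mathbb S^{d-1}$ and $\gamma^{\mathcal C}_{x,v}$ is the probability measure on $\mathbb R$ with density proportional to $h\mapsto\gamma^{\mathcal C}(x+hv)$. Let $\mathsf{TV}(\eta,\nu)=2\sup_A|\eta(A)-\nu(A)|$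 be the total variation norm of $\eta-\nu$ (so the bound holds a fortiori for the distance normalized without the factor $2$). Then for all $\epsilon\in(0,1)$ and $x,\tilde x\in\mathbb R^d$, \[ \mathsf{TV}\bigl(\pi_{\mathrm{H\&R}}(x,\cdot),\pi_{\mathrm{H\&R}}(\tilde x,\cdot)\bigr)\le\sqrt2\Bigl(C_1(x)^{1/2}|x-\tilde x|_{\mathcal C^{-1/2}}+C_2(x)^{1/2}|x-\tilde x|_{\mathcal C^{-1/2}}^{1/2}+C_3(x)\epsilon^{1/2}\Bigr), \] where \[ C_1(x)=\epsilon^{-1}m^{-1/2}|x|_{\mathcal C^{-1/2}}+2\epsilon M^{1/2}+1, \] \[ C_2(x)=2\epsilon^{-1}m^{-1/2}|x|_{\mathcal C^{-1/2}}^2+2|x|_{\mathcal C^{-1/2}}+\bigl(\epsilon^{-1}m^{-1/2}+2\epsilon\kappa^{1/2}\bigr)(d-1)+2\epsilon^{-1}m^{-1/2}+\bigl(M^{1/2}+m^{-1/2}+2\bigr)\kappa^{1/2}, \] \[ C_3(x)=\sqrt3\,M^{1/4}|x|_{\mathcal C^{-1/2}}+\sqrt2\,(1+\log\epsilon^{-1})^{1/2}M^{1/4}\sqrt{d-1}+\sqrt2\,M^{1/4}\bigl(M^{1/2}+m^{-1/2}+2\bigr)^{1/2}.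 \] -/

import Mathlib

open MeasureTheory Metric
open scoped ENNReal MatrixOrder

noncomputable section

namespace HitAndRun

/-- Euclidean space `ℝ^d`. -/
abbrev Space (d : ℕ) : Type := EuclideanSpace ℝ (Fin d)

/-- The uniform distribution `σ_{d-1}` on the unit sphere of `ℝ^d`: normalized surface measure. -/
def unifSphere (d : ℕ) : Measure (sphere (0 : Space d) 1) :=
  ((volume : Measure (Space d)).toSphere Set.univ)⁻¹ • (volume : Measure (Space d)).toSphere

/-- The displacement measure `μ_{x,v}(dh) ∝ μ(x + h v) dh` on `ℝ`, normalized to total mass one,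
for a target with Lebesgue density `f`. -/
def displacement {d : ℕ} (f : Space d → ℝ≥0∞) (x v : Space d) : Measure ℝ :=
  (∫⁻ s : ℝ, f (x + s • v))⁻¹ • (volume : Measure ℝ).withDensity (fun h => f (x + h • v))

/-- The conditional distribution of the target on the line through `x` in direction `v`:
the image of the displacement measure under `h ↦ x + h v`. -/
def lineLaw {d : ℕ} (f : Space d → ℝ≥0∞) (x v : Space d) : Measure (Space d) :=
  (displacement f x v).map (fun h : ℝ => x + h • v)

/-- The Hit-and-Run transition distribution `π_{H&R}(x, ·)` for the target with Lebesgue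
density `f`: draw `v` uniformly from the sphere, then draw from the target conditioned on the line
through `x` in direction `v`. -/
def hitAndRun {d : ℕ} (f : Space d → ℝ≥0∞) (x : Space d) : Measure (Space d) :=
  (unifSphere d).bind (fun v => lineLaw f x (v : Space d))

theorem measurable_lineLaw {d : ℕ} {f : Space d → ℝ≥0∞} (hf : Measurable f) (x : Space d) :
    Measurable (fun v : sphere (0 : Space d) 1 => lineLaw f x (v : Space d)) := by
  refine Measure.measurable_of_measurable_coe _ fun A hA => ?_
  have hm : ∀ v : Space d, Measurable (fun h : ℝ => x + h • v) := fun v => by fun_prop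
  have hj : Measurable (fun p : sphere (0 : Space d) 1 × ℝ => x + p.2 • (p.1 : Space d)) := by
    fun_prop
  have key : ∀ v : sphere (0 : Space d) 1, lineLaw f x (v : Space d) A =
      (∫⁻ s : ℝ, f (x + s • (v : Space d)))⁻¹ *
        ∫⁻ h : ℝ, A.indicator f (x + h • (v : Space d)) := by
    intro v
    rw [lineLaw, Measure.map_apply (hm v) hA, displacement, Measure.smul_apply,
      withDensity_apply _ (hm v hA), ← lintegral_indicator (hm v hA), smul_eq_mul]
    rfl
  simp_rw [key]
  exact ((hf.comp hj).lintegral_prod_right').inv.mul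
    (((hf.indicator hA).comp hj).lintegral_prod_right')

/-- The Hit-and-Run transition distribution as an iterated integral:
`π_{H&R}(x, A) = ∫ ∫ 1_A(x + h v) μ_{x,v}(dh) σ_{d-1}(dv)`. -/
theorem hitAndRun_apply {d : ℕ} {f : Space d → ℝ≥0∞} (hf : Measurable f) (x : Space d)
    {A : Set (Space d)} (hA : MeasurableSet A) :
    hitAndRun f x A = ∫⁻ v : sphere (0 : Space d) 1, ∫⁻ h : ℝ,
      A.indicator 1 (x + h • (v : Space d)) ∂(displacement f x (v : Space d)) ∂(unifSphere d) := by
  rw [hitAndRun, Measure.bind_apply hA (measurable_lineLaw hf x).aemeasurable]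
  refine lintegral_congr fun v => ?_
  have hm : Measurable (fun h : ℝ => x + h • (v : Space d)) := by fun_prop
  rw [lineLaw, Measure.map_apply hm hA, ← lintegral_indicator_one (hm hA)]
  rfl

/-- The Lebesgue density of the centered Gaussian measure `N(0, C)` on `ℝ^d`,
`(2π)^{-d/2} (det C)^{-1/2} exp(-x ⋅ C⁻¹ x / 2)`. -/
def gaussianDensity {d : ℕ} (C : Matrix (Fin d) (Fin d) ℝ) (x : Space d) : ℝ≥0∞ :=
  ENNReal.ofReal ((√((2 * Real.pi) ^ d * C.det))⁻¹ *
    Real.exp (-(inner ℝ x (C⁻¹.toEuclideanLin x)) / 2))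

/-- The norm `|x|_{C^{-1/2}} = |C^{-1/2} x|`, where `C^{-1/2}` is the positive square root
of `C⁻¹`. -/
def covNorm {d : ℕ} (C : Matrix (Fin d) (Fin d) ℝ) (x : Space d) : ℝ :=
  ‖(CFC.sqrt C⁻¹).toEuclideanLin x‖

/-- The total variation distance, normalized as the total variation norm of the signed measure
`η - ν`, that is, twice the largest difference of the probabilities of an event. -/
def tvDist {Ω : Type*} [MeasurableSpace Ω] (η ν : Measure Ω) : ℝ :=
  2 * ⨆ A : {A : Set Ω // MeasurableSet A}, |η.real A - ν.real A|

/-- The constant `C₁`; `r` stands for `|x|_{C^{-1/2}}`. -/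
def const₁ (M m ε r : ℝ) : ℝ :=
  ε⁻¹ * (√m)⁻¹ * r + 2 * ε * √M + 1

/-- The constant `C₂`; `r` stands for `|x|_{C^{-1/2}}`. -/
def const₂ (d : ℕ) (M m κ ε r : ℝ) : ℝ :=
  2 * ε⁻¹ * (√m)⁻¹ * r ^ 2 + 2 * r + (ε⁻¹ * (√m)⁻¹ + 2 * ε * √κ) * ((d : ℝ) - 1)
    + 2 * ε⁻¹ * (√m)⁻¹ + (√M + (√m)⁻¹ + 2) * √κ

/-- The constant `C₃`; `r` stands for `|x|_{C^{-1/2}}`. -/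
def const₃ (d : ℕ) (M m ε r : ℝ) : ℝ :=
  √3 * M ^ (1 / 4 : ℝ) * r
    + √2 * √(1 + Real.log ε⁻¹) * M ^ (1 / 4 : ℝ) * √((d : ℝ) - 1)
    + √2 * M ^ (1 / 4 : ℝ) * √(√M + (√m)⁻¹ + 2)

end HitAndRun

end

/-! Pinsker's inequality reduces the claim to bounding the relative entropy of `π(x,·)` with respect
to `π(x',·)`. Write `T = C^{-1/2}`, `n = d - 1`, `D = |T(x - x')|`, `δ = D/√m`. Along a line the
Gaussian is again Gaussian, so the kernel has an explicit Lebesgue density. With `z = y - x` and `z'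
= y - x'`, the ratio of the two densities at `y` is a product of three factors: `(|z'|/|z|)^n` from
polar coordinates, `(|Tz|/|z|)(|z'|/|Tz'|)` from the variances along the lines, and `exp((p -
p')/2)`, where `p`, `p'` are the squared distances from the origin to the `T`-images of the lines
through `x, y` and `x', y`.

Away from `x` the logarithms of all three factors are `O(D)`, with constants involving `1/ε`. Near
`x` they are bounded crudely, and the only singularity is `-n log|z|`. This gives a majorant
depending on `|y - x|` alone (`log_density_ratio_le`). Under `π(x,·)` this radius is `|h|`, with `h`
Gaussian of density at most `√M/2`, so the region near `x` contributes only `O(ε log(1/ε))` and `O(ε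
+ δ)` (`lintegral_densityBound_le`). Taking the square root of the sum splits the terms in `D` from
those in `ε`. -/

namespace HitAndRun

open scoped RealInnerProductSpace

/-! ### Pinsker's inequality -/

/-- Hoeffding's bound for the moment generating function of the indicator of an event. -/
theorem integral_exp_indicator_le {Ω : Type*} [MeasurableSpace Ω] (Q : Measure Ω)
    [IsProbabilityMeasure Q] {A : Set Ω} (hA : MeasurableSet A) (t : ℝ) :
    ∫ ω, Real.exp (t * A.indicator 1 ω) ∂Q ≤ Real.exp (t * Q.real A + t ^ 2 / 8) := by
  have hX : Measurable (A.indicator (1 : Ω → ℝ)) := measurable_one.indicator hA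
  have h := (ProbabilityTheory.hasSubgaussianMGF_of_mem_Icc (μ := Q) (a := 0) (b := 1)
    hX.aemeasurable (Filter.Eventually.of_forall fun ω => by
      by_cases h : ω ∈ A <;> simp [h])).mgf_le t
  rw [ProbabilityTheory.mgf, integral_indicator_one hA] at h
  have e : ∀ ω, Real.exp (t * A.indicator 1 ω)
      = Real.exp (t * Q.real A) * Real.exp (t * (A.indicator 1 ω - Q.real A)) := fun ω => by
    rw [← Real.exp_add]; congr 1; ring
  simp_rw [e]
  rw [integral_const_mul, Real.exp_add]
  refine mul_le_mul_of_nonneg_left (h.trans_eq ?_) (Real.exp_pos _).le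
  congr 1
  norm_num
  ring

/-- A form of **Pinsker's inequality**: if `Q` dominates `exp (-W) • P` and the mean of `W` under
`P` is at most `K`, then the probabilities of an event differ by at most `√(K / 2)`. -/
theorem abs_measureReal_sub_le_sqrt {Ω : Type*} [MeasurableSpace Ω] (P Q : Measure Ω)
    [IsProbabilityMeasure P] [IsProbabilityMeasure Q] {W : Ω → ℝ} (hWm : Measurable W)
    (hW : Integrable W P) {K : ℝ} (hK : ∫ ω, W ω ∂P ≤ K)
    (hPQ : P.withDensity (fun ω => ENNReal.ofReal (Real.exp (-W ω))) ≤ Q)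
    {A : Set Ω} (hA : MeasurableSet A) :
    |P.real A - Q.real A| ≤ √(K / 2) := by
  have hX : Measurable (A.indicator (1 : Ω → ℝ)) := measurable_one.indicator hA
  -- Donsker–Varadhan duality: Jensen for `exp` under `P` applied to `t 1_A - W`, domination by `Q`,
  -- then Hoeffding.
  have key : ∀ t : ℝ, t * P.real A - K ≤ t * Q.real A + t ^ 2 / 8 := by
    intro t
    have hgm : Measurable (fun ω => Real.exp (t * A.indicator 1 ω)) := by fun_prop
    have hint : Integrable (fun ω => Real.exp (t * A.indicator 1 ω)) Q := by
      refine Integrable.of_bound hgm.aestronglyMeasurable (Real.exp |t|)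
        (Filter.Eventually.of_forall fun ω => ?_)
      rw [Real.norm_eq_abs, Real.abs_exp]
      refine Real.exp_le_exp.2 ?_
      by_cases h : ω ∈ A <;> simp [h, le_abs_self]
    have hle : ∫⁻ ω, ENNReal.ofReal (Real.exp (t * A.indicator 1 ω - W ω)) ∂P
        ≤ ENNReal.ofReal (∫ ω, Real.exp (t * A.indicator 1 ω) ∂Q) := by
      rw [ofReal_integral_eq_lintegral_ofReal hint
        (Filter.Eventually.of_forall fun ω => (Real.exp_pos _).le)]
      refine le_trans (le_of_eq ?_) (lintegral_mono' hPQ le_rfl)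
      rw [lintegral_withDensity_eq_lintegral_mul _ (by fun_prop) (by fun_prop)]
      refine lintegral_congr fun ω => ?_
      rw [Pi.mul_apply, ← ENNReal.ofReal_mul (Real.exp_pos _).le, ← Real.exp_add]
      congr 2; ring
    have hfin : Integrable (fun ω => Real.exp (t * A.indicator 1 ω - W ω)) P := by
      refine ⟨by fun_prop, ?_⟩
      rw [hasFiniteIntegral_iff_ofReal (Filter.Eventually.of_forall fun ω => (Real.exp_pos _).le)]
      exact hle.trans_lt ENNReal.ofReal_lt_top
    rw [← ofReal_integral_eq_lintegral_ofReal hfin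
      (Filter.Eventually.of_forall fun ω => (Real.exp_pos _).le),
      ENNReal.ofReal_le_ofReal_iff (integral_nonneg fun ω => (Real.exp_pos _).le)] at hle
    have hg : Integrable (fun ω => t * A.indicator 1 ω) P :=
      ((integrable_const (1 : ℝ)).indicator hA).const_mul t
    have hJ := convexOn_exp.map_integral_le (μ := P) (f := fun ω => t * A.indicator 1 ω - W ω)
      Real.continuous_exp.continuousOn isClosed_univ (by simp) (hg.sub hW) hfin
    rw [integral_sub hg hW, integral_const_mul, integral_indicator_one hA] at hJ
    have := Real.exp_le_exp.1 ((hJ.trans hle).trans (integral_exp_indicator_le Q hA t))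
    linarith
  refine Real.abs_le_sqrt ?_
  -- This `t` maximizes `t Δ - t²/8` for `Δ = P(A) - Q(A)`, giving `2Δ² ≤ K`.
  have := key (4 * (P.real A - Q.real A))
  nlinarith

/-! ### Polar coordinates -/

/-- Integration in polar coordinates. -/
theorem lintegral_eq_lintegral_toSphere {E : Type*} [NormedAddCommGroup E] [NormedSpace ℝ E]
    [MeasurableSpace E] [BorelSpace E] [FiniteDimensional ℝ E] [Nontrivial E]
    (μ : Measure E) [μ.IsAddHaarMeasure] {G : E → ℝ≥0∞} (hG : Measurable G) :
    ∫⁻ z, G z ∂μ = ∫⁻ v : sphere (0 : E) 1, ∫⁻ h in Set.Ioi (0 : ℝ),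
      ENNReal.ofReal (h ^ (Module.finrank ℝ E - 1)) * G (h • (v : E)) ∂volume ∂μ.toSphere := by
  have hm : Measurable (fun p : sphere (0 : E) 1 × Set.Ioi (0 : ℝ) => G ((p.2 : ℝ) • (p.1 : E))) :=
    hG.comp (by fun_prop)
  calc ∫⁻ z, G z ∂μ = ∫⁻ z : ({0}ᶜ : Set E), G z ∂(μ.comap (↑)) := by
        rw [lintegral_subtype_comap (measurableSet_singleton _).compl,
          restrict_compl_singleton]
    _ = ∫⁻ z : ({0}ᶜ : Set E), (fun p : sphere (0 : E) 1 × Set.Ioi (0 : ℝ) =>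
          G ((p.2 : ℝ) • (p.1 : E))) (homeomorphUnitSphereProd E z) ∂(μ.comap (↑)) := by
        refine lintegral_congr fun z => ?_
        have hz : ‖(z : E)‖ ≠ 0 := norm_ne_zero_iff.2 z.2
        simp [smul_smul, hz]
    _ = ∫⁻ p, G ((p.2 : ℝ) • (p.1 : E))
          ∂(μ.toSphere.prod (Measure.volumeIoiPow (Module.finrank ℝ E - 1))) :=
        μ.measurePreserving_homeomorphUnitSphereProd.lintegral_comp hm
    _ = _ := by
        rw [lintegral_prod _ hm.aemeasurable]
        refine lintegral_congr fun v => ?_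
        rw [Measure.volumeIoiPow, lintegral_withDensity_eq_lintegral_mul _ (by fun_prop)
          (g := fun h : Set.Ioi (0 : ℝ) => G ((h : ℝ) • (v : E)))
          (hG.comp (by fun_prop))]
        exact lintegral_subtype_comap measurableSet_Ioi
          (fun h : ℝ => ENNReal.ofReal (h ^ (Module.finrank ℝ E - 1)) * G (h • (v : E)))

/-- Integration over all lines through the origin. -/
theorem lintegral_toSphere_lintegral_smul {E : Type*} [NormedAddCommGroup E] [NormedSpace ℝ E]
    [MeasurableSpace E] [BorelSpace E] [FiniteDimensional ℝ E] [Nontrivial E]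
    (μ : Measure E) [μ.IsAddHaarMeasure] {F : E → ℝ≥0∞} (hF : Measurable F) :
    ∫⁻ v : sphere (0 : E) 1, ∫⁻ h : ℝ, F (h • (v : E)) ∂volume ∂μ.toSphere
      = 2 * ∫⁻ z, (ENNReal.ofReal (‖z‖ ^ (Module.finrank ℝ E - 1)))⁻¹ * F z ∂μ := by
  set n := Module.finrank ℝ E - 1
  have hray : ∀ G : E → ℝ≥0∞, Measurable G →
      ∫⁻ v : sphere (0 : E) 1, ∫⁻ h in Set.Ioi (0 : ℝ), G (h • (v : E)) ∂volume ∂μ.toSphere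
        = ∫⁻ z, (ENNReal.ofReal (‖z‖ ^ n))⁻¹ * G z ∂μ := by
    intro G hG
    -- The Jacobian `h^n` cancels the weight `‖z‖^{-n}`.
    rw [lintegral_eq_lintegral_toSphere μ (by fun_prop)]
    refine lintegral_congr fun v => setLIntegral_congr_fun measurableSet_Ioi fun h hh => ?_
    have hh : 0 < h := hh
    have hv : ‖(v : E)‖ = 1 := norm_eq_of_mem_sphere v
    simp only [norm_smul, hv, mul_one, Real.norm_eq_abs, abs_of_pos hh]
    rw [← mul_assoc, ENNReal.mul_inv_cancel (by simpa using pow_pos hh n) ENNReal.ofReal_ne_top,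
      one_mul]
  -- The two rays contribute equally because `μ` is invariant under negation; hence the factor 2.
  have hsplit : ∀ v : sphere (0 : E) 1, ∫⁻ h : ℝ, F (h • (v : E))
      = (∫⁻ h in Set.Ioi (0 : ℝ), F (h • (v : E)))
        + ∫⁻ h in Set.Ioi (0 : ℝ), F (-(h • (v : E))) := by
    intro v
    rw [← lintegral_add_compl _ (measurableSet_Ioi (a := (0 : ℝ))), Set.compl_Ioi,
      restrict_Iio_eq_restrict_Iic.symm]
    congr 1
    have := (Measure.measurePreserving_neg (volume : Measure ℝ)).setLIntegral_comp_preimage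
      (measurableSet_Iio (a := (0 : ℝ))) (f := fun h : ℝ => F (h • (v : E))) (by fun_prop)
    rw [← this]
    simp [Set.neg_preimage]
  simp_rw [hsplit]
  have hm : Measurable (fun p : sphere (0 : E) 1 × ℝ => F (p.2 • (p.1 : E))) := hF.comp (by fun_prop)
  rw [lintegral_add_left hm.lintegral_prod_right', hray F hF,
    hray (fun z => F (-z)) (by fun_prop), two_mul]
  congr 1
  rw [← (Measure.measurePreserving_neg μ).lintegral_comp (by fun_prop)]
  simp

/-! ### Distances to lines -/

/-- The squared distance of `a` from the line spanned by `b`. -/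
noncomputable def perpSq {F : Type*} [NormedAddCommGroup F] [InnerProductSpace ℝ F] (a b : F) : ℝ :=
  ‖a‖ ^ 2 - (⟪a, b⟫ / ‖b‖) ^ 2

section
variable {F : Type*} [NormedAddCommGroup F] [InnerProductSpace ℝ F]

/-- Pythagoras, splitting `a - t • b` into its parts orthogonal and parallel to `b`. -/
theorem norm_sub_smul_sq {a b : F} (hb : b ≠ 0) (t : ℝ) :
    ‖a - t • b‖ ^ 2 = perpSq a b + (t * ‖b‖ - ⟪a, b⟫ / ‖b‖) ^ 2 := by
  have : ‖b‖ ≠ 0 := norm_ne_zero_iff.2 hb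
  rw [norm_sub_sq_real, perpSq, norm_smul, inner_smul_right, mul_pow, Real.norm_eq_abs, sq_abs]
  field_simp
  ring

theorem perpSq_nonneg (a b : F) : 0 ≤ perpSq a b := by
  rcases eq_or_ne b 0 with rfl | hb
  · simp [perpSq]
  · have := norm_sub_smul_sq (a := a) hb (⟪a, b⟫ / ‖b‖ / ‖b‖)
    rw [div_mul_cancel₀ _ (norm_ne_zero_iff.2 hb), sub_self] at this
    nlinarith [sq_nonneg (‖a - (⟪a, b⟫ / ‖b‖ / ‖b‖) • b‖)]

theorem perpSq_le (a b : F) : perpSq a b ≤ ‖a‖ ^ 2 := by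
  rw [perpSq]; nlinarith [sq_nonneg (⟪a, b⟫ / ‖b‖)]

theorem sqrt_perpSq_le_norm_sub_smul {a b : F} (hb : b ≠ 0) (t : ℝ) :
    √(perpSq a b) ≤ ‖a - t • b‖ := by
  rw [Real.sqrt_le_left (norm_nonneg _), norm_sub_smul_sq hb t]
  nlinarith [sq_nonneg (t * ‖b‖ - ⟪a, b⟫ / ‖b‖)]

/-- The minimizer is the orthogonal projection; the bound on its length controls the error when the
line is rotated. -/
theorem exists_sqrt_perpSq_eq {a b : F} (hb : b ≠ 0) :
    ∃ t : ℝ, |t| * ‖b‖ ≤ ‖a‖ ∧ √(perpSq a b) = ‖a - t • b‖ := by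
  have hb' := norm_pos_iff.2 hb
  refine ⟨⟪a, b⟫ / ‖b‖ / ‖b‖, ?_, ?_⟩
  · rw [abs_div, abs_div, abs_norm, div_mul_cancel₀ _ hb'.ne', div_le_iff₀ hb']
    exact abs_real_inner_le_norm a b
  · rw [← Real.sqrt_sq (norm_nonneg (a - _)), norm_sub_smul_sq hb,
      div_mul_cancel₀ _ hb'.ne', sub_self]
    simp

theorem perpSq_add_smul {a b : F} (hb : b ≠ 0) (t : ℝ) : perpSq (a + t • b) b = perpSq a b := by
  have : ‖b‖ ≠ 0 := norm_ne_zero_iff.2 hb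
  have h := norm_sub_smul_sq (a := a) hb (-t)
  rw [neg_smul, sub_neg_eq_add] at h
  rw [perpSq, h, inner_add_left, inner_smul_left, real_inner_self_eq_norm_sq]
  simp only [conj_trivial]
  field_simp
  ring

/-- The distance of `w` from a line through the origin depends in a Lipschitz way on the
direction of the line. -/
theorem sqrt_perpSq_le_add {w b c : F} (hb : b ≠ 0) (hc : c ≠ 0) :
    √(perpSq w b) ≤ √(perpSq w c) + ‖w‖ * ‖b - c‖ / ‖b‖ := by
  have hb' := norm_pos_iff.2 hb
  have hc' := norm_pos_iff.2 hc
  obtain ⟨t, ht, hw⟩ := exists_sqrt_perpSq_eq (a := w) hc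
  obtain ⟨s, -, hs⟩ := exists_sqrt_perpSq_eq (a := c) hb
  have hcb : √(perpSq c b) ≤ ‖c‖ * (‖b - c‖ / ‖b‖) := by
    -- the sine of the angle is symmetric in the two directions
    have hsym : perpSq c b * ‖b‖ ^ 2 = perpSq b c * ‖c‖ ^ 2 := by
      rw [perpSq, perpSq, real_inner_comm]; field_simp
    have h1 : √(perpSq b c) ≤ ‖b - c‖ := by
      simpa using sqrt_perpSq_le_norm_sub_smul (a := b) hc 1
    have h2 : √(perpSq c b) * ‖b‖ = √(perpSq b c) * ‖c‖ := by
      have h3 := congrArg Real.sqrt hsym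
      rwa [Real.sqrt_mul (perpSq_nonneg _ _), Real.sqrt_mul (perpSq_nonneg _ _),
        Real.sqrt_sq hb'.le, Real.sqrt_sq hc'.le] at h3
    rw [mul_div_assoc', le_div_iff₀ hb', h2, mul_comm]
    gcongr
  -- Project `w` to `t • c`, then `c` to `s • b`; the composite point lies on the line of `b`.
  calc √(perpSq w b) ≤ ‖w - (t * s) • b‖ := sqrt_perpSq_le_norm_sub_smul hb _
    _ = ‖(w - t • c) + t • (c - s • b)‖ := by congr 1; module
    _ ≤ ‖w - t • c‖ + |t| * ‖c - s • b‖ := by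
        simpa [norm_smul] using norm_add_le (w - t • c) (t • (c - s • b))
    _ ≤ √(perpSq w c) + |t| * (‖c‖ * (‖b - c‖ / ‖b‖)) := by rw [hw, ← hs]; gcongr
    _ ≤ _ := by
        rw [← mul_assoc, mul_div_assoc]
        gcongr

/-- Comparison of the distances of the origin from the lines joining a point `w` with `a`
and `a'`. -/
theorem perpSq_sub_perpSq_le {a a' w : F} (ha : w ≠ a) (ha' : w ≠ a') :
    (perpSq a (w - a) - perpSq a' (w - a')) / 2
      ≤ ‖a‖ ^ 2 * ‖a - a'‖ / ‖w - a‖ + ‖a‖ * ‖a - a'‖ := by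
  have hb := sub_ne_zero.2 ha
  have hb' := norm_pos_iff.2 hb
  -- Both lines pass through `w`, so `w` may replace `a` and `a'`; only the direction then differs.
  have e1 : perpSq w (w - a) = perpSq a (w - a) := by
    rw [← perpSq_add_smul hb 1 (a := a)]; simp
  have e2 : perpSq w (w - a') = perpSq a' (w - a') := by
    rw [← perpSq_add_smul (sub_ne_zero.2 ha') 1 (a := a')]; simp
  have h := sqrt_perpSq_le_add (w := w) hb (sub_ne_zero.2 ha')
  rw [e1, e2, show w - a - (w - a') = -(a - a') by abel, norm_neg] at h
  set p := perpSq a (w - a)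
  set q := perpSq a' (w - a')
  have hp : √p ≤ ‖a‖ := Real.sqrt_le_iff.2 ⟨norm_nonneg _, perpSq_le _ _⟩
  have hw : ‖w‖ ≤ ‖a‖ + ‖w - a‖ := by simpa using norm_add_le a (w - a)
  have hd : √p - √q ≤ (‖a‖ + ‖w - a‖) * ‖a - a'‖ / ‖w - a‖ := by
    have : ‖w‖ * ‖a - a'‖ / ‖w - a‖ ≤ (‖a‖ + ‖w - a‖) * ‖a - a'‖ / ‖w - a‖ := by gcongr
    linarith
  have hp2 : √p ^ 2 = p := Real.sq_sqrt (perpSq_nonneg _ _)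
  have hq2 : √q ^ 2 = q := Real.sq_sqrt (perpSq_nonneg _ _)
  have h0 : 0 ≤ (‖a‖ + ‖w - a‖) * ‖a - a'‖ / ‖w - a‖ := by positivity
  -- The gap is `(√p - √q)² / 2`, so no sign of `p - q` is needed.
  calc (p - q) / 2 ≤ √p * (√p - √q) := by
        nlinarith [sq_nonneg (√p - √q)]
    _ ≤ √p * ((‖a‖ + ‖w - a‖) * ‖a - a'‖ / ‖w - a‖) := by gcongr
    _ ≤ ‖a‖ * ((‖a‖ + ‖w - a‖) * ‖a - a'‖ / ‖w - a‖) := by gcongr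
    _ = _ := by field_simp

end

/-! ### The Gaussian Hit-and-Run kernel and its density -/

theorem lintegral_hitAndRun {d : ℕ} {f : Space d → ℝ≥0∞} (hf : Measurable f) (x : Space d)
    {g : Space d → ℝ≥0∞} (hg : Measurable g) :
    ∫⁻ y, g y ∂hitAndRun f x = ∫⁻ v : sphere (0 : Space d) 1, ∫⁻ h : ℝ,
      g (x + h • (v : Space d)) ∂(displacement f x (v : Space d)) ∂(unifSphere d) := by
  rw [hitAndRun, Measure.lintegral_bind (measurable_lineLaw hf x).aemeasurable hg.aemeasurable]
  refine lintegral_congr fun v => ?_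
  rw [lineLaw, lintegral_map hg (by fun_prop)]

theorem isProbabilityMeasure_unifSphere {d : ℕ} (hd : 1 ≤ d) :
    IsProbabilityMeasure (unifSphere d) := by
  have : Nonempty (Fin d) := ⟨⟨0, hd⟩⟩
  refine ⟨?_⟩
  rw [unifSphere, Measure.smul_apply, smul_eq_mul]
  exact ENNReal.inv_mul_cancel
    (Measure.measure_univ_eq_zero.not.2 (Measure.toSphere_ne_zero _)) (measure_ne_top _ _)

section
variable {d : ℕ} (T : Space d →ₗ[ℝ] Space d) (K : ℝ)

/-- The unnormalized density `K exp (-|T x|² / 2)`. -/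
noncomputable def gaussianWeight (x : Space d) : ℝ≥0∞ :=
  ENNReal.ofReal (K * Real.exp (-‖T x‖ ^ 2 / 2))

theorem measurable_gaussianWeight : Measurable (gaussianWeight T K) := by
  have : Measurable T := T.continuous_of_finiteDimensional.measurable
  unfold gaussianWeight
  fun_prop

/-- The mass of the line through `x` in direction `v`. -/
noncomputable def lineMass (x v : Space d) : ℝ :=
  K * (√(2 * Real.pi) / ‖T v‖) * Real.exp (-perpSq (T x) (T v) / 2)

variable {T K}

theorem lineMass_pos (hK : 0 < K) (x : Space d) {v : Space d} (hv : T v ≠ 0) :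
    0 < lineMass T K x v := by
  have := norm_pos_iff.2 hv
  unfold lineMass
  positivity

/-- Completing the square in `s`: the orthogonal part gives the mass, the parallel part a Gaussian
of variance `‖T v‖⁻²`. -/
theorem gaussianWeight_add_smul (hK : 0 < K) (x : Space d) {v : Space d} (hv : T v ≠ 0) (s : ℝ) :
    gaussianWeight T K (x + s • v) = ENNReal.ofReal (lineMass T K x v) *
      ProbabilityTheory.gaussianPDF (-(⟪T x, T v⟫ / ‖T v‖ ^ 2))
        (Real.toNNReal ((‖T v‖ ^ 2)⁻¹)) s := by
  have hb := norm_pos_iff.2 hv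
  have hn : ‖T (x + s • v)‖ ^ 2 = perpSq (T x) (T v)
      + (s + ⟪T x, T v⟫ / ‖T v‖ ^ 2) ^ 2 * ‖T v‖ ^ 2 := by
    have := norm_sub_smul_sq (a := T x) hv (-s)
    rw [neg_smul, sub_neg_eq_add] at this
    rw [map_add, map_smul, this]
    field_simp
    ring
  rw [ProbabilityTheory.gaussianPDF, ProbabilityTheory.gaussianPDFReal, gaussianWeight,
    ← ENNReal.ofReal_mul (lineMass_pos hK x hv).le, hn, lineMass,
    Real.coe_toNNReal _ (by positivity)]
  congr 1
  have h1 : √(2 * Real.pi * (‖T v‖ ^ 2)⁻¹) = √(2 * Real.pi) / ‖T v‖ := by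
    rw [← div_eq_mul_inv, Real.sqrt_div' _ (by positivity), Real.sqrt_sq hb.le]
  rw [h1, show -(perpSq (T x) (T v) + (s + ⟪T x, T v⟫ / ‖T v‖ ^ 2) ^ 2 * ‖T v‖ ^ 2) / 2
    = -perpSq (T x) (T v) / 2
      + -(s - -(⟪T x, T v⟫ / ‖T v‖ ^ 2)) ^ 2 / (2 * (‖T v‖ ^ 2)⁻¹) by field_simp; ring, Real.exp_add]
  have : √(2 * Real.pi) ≠ 0 := by positivity
  field_simp

theorem lintegral_gaussianWeight_add_smul (hK : 0 < K) (x : Space d) {v : Space d}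
    (hv : T v ≠ 0) :
    ∫⁻ s : ℝ, gaussianWeight T K (x + s • v) = ENNReal.ofReal (lineMass T K x v) := by
  have hb := norm_pos_iff.2 hv
  simp_rw [gaussianWeight_add_smul hK x hv]
  rw [lintegral_const_mul _ (ProbabilityTheory.measurable_gaussianPDF _ _),
    ProbabilityTheory.lintegral_gaussianPDF_eq_one _ (by simpa using hv), mul_one]

theorem displacement_gaussianWeight (hK : 0 < K) (x : Space d) {v : Space d} (hv : T v ≠ 0) :
    displacement (gaussianWeight T K) x v = ProbabilityTheory.gaussianReal
      (-(⟪T x, T v⟫ / ‖T v‖ ^ 2)) (Real.toNNReal ((‖T v‖ ^ 2)⁻¹)) := by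
  have hb := norm_pos_iff.2 hv
  rw [displacement, lintegral_gaussianWeight_add_smul hK x hv,
    ProbabilityTheory.gaussianReal_of_var_ne_zero _ (by simpa using hv)]
  simp_rw [gaussianWeight_add_smul hK x hv]
  rw [← withDensity_smul _ (by fun_prop)]
  congr 1
  ext s
  simp only [Pi.smul_apply, smul_eq_mul]
  rw [← mul_assoc, ENNReal.inv_mul_cancel _ ENNReal.ofReal_ne_top, one_mul]
  simpa using lineMass_pos hK x hv

/-- The peak of the Gaussian density is `‖T v‖ / √(2π)`, and `2 ≤ √(2π)`. This is what makes small
displacements unlikely. -/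
theorem displacement_gaussianWeight_le (hK : 0 < K) (x : Space d) {v : Space d} (hv : T v ≠ 0) :
    displacement (gaussianWeight T K) x v ≤ ENNReal.ofReal (‖T v‖ / 2) • volume := by
  have hb := norm_pos_iff.2 hv
  rw [displacement_gaussianWeight hK x hv,
    ProbabilityTheory.gaussianReal_of_var_ne_zero _ (by simpa using hv), ← withDensity_const]
  refine withDensity_mono (Filter.Eventually.of_forall fun s => ENNReal.ofReal_le_ofReal ?_)
  rw [ProbabilityTheory.gaussianPDFReal, Real.coe_toNNReal _ (by positivity),
    ← div_eq_mul_inv, Real.sqrt_div' _ (by positivity), Real.sqrt_sq hb.le, inv_div]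
  have h2 : (2 : ℝ) ≤ √(2 * Real.pi) :=
    Real.le_sqrt_of_sq_le (by nlinarith [Real.pi_gt_three])
  have h3 : Real.exp (-(s - -(⟪T x, T v⟫ / ‖T v‖ ^ 2)) ^ 2 / (2 * (‖T v‖ ^ 2)⁻¹)) ≤ 1 := by
    refine Real.exp_le_one_iff.2 ?_
    rw [neg_div, neg_nonpos]
    positivity
  calc _ ≤ ‖T v‖ / √(2 * Real.pi) * 1 := by gcongr
    _ ≤ ‖T v‖ / 2 := by rw [mul_one]; gcongr

theorem isProbabilityMeasure_hitAndRun_gaussianWeight (hT : ∀ v, v ≠ 0 → T v ≠ 0) (hd : 1 ≤ d)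
    (hK : 0 < K) (x : Space d) :
    IsProbabilityMeasure (hitAndRun (gaussianWeight T K) x) := by
  have := isProbabilityMeasure_unifSphere hd
  refine ⟨?_⟩
  rw [← lintegral_one,
    lintegral_hitAndRun (measurable_gaussianWeight T K) x measurable_const]
  have h : ∀ v : sphere (0 : Space d) 1,
      ∫⁻ _ : ℝ, 1 ∂(displacement (gaussianWeight T K) x (v : Space d)) = 1 := fun v => by
    rw [displacement_gaussianWeight hK x (hT v (ne_zero_of_mem_unit_sphere v)), lintegral_one,
      measure_univ]
  simp [h]

/-- The Hit-and-Run transition distribution is absolutely continuous. -/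
theorem lintegral_hitAndRun_gaussianWeight (hT : ∀ v, v ≠ 0 → T v ≠ 0) (hd : 1 ≤ d)
    (hK : 0 < K) (x : Space d) {g : Space d → ℝ≥0∞} (hg : Measurable g) :
    ∫⁻ y, g y ∂hitAndRun (gaussianWeight T K) x =
      ((volume : Measure (Space d)).toSphere Set.univ)⁻¹ * (2 * ∫⁻ y,
        ENNReal.ofReal ((‖y - x‖ ^ (d - 1))⁻¹ * (‖y - x‖ * lineMass T K x (y - x))⁻¹)
          * (gaussianWeight T K y * g y)) := by
  have : Nonempty (Fin d) := ⟨⟨0, hd⟩⟩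
  have hf := measurable_gaussianWeight T K
  have hTm : Measurable T := T.continuous_of_finiteDimensional.measurable
  have hlm : Measurable (fun z => lineMass T K x z) := by
    unfold lineMass perpSq
    fun_prop
  set F : Space d → ℝ≥0∞ := fun z => ENNReal.ofReal ((‖z‖ * lineMass T K x z)⁻¹)
    * (gaussianWeight T K (x + z) * g (x + z)) with hFdef
  have hF : Measurable F := by fun_prop
  rw [lintegral_hitAndRun hf x hg, unifSphere, lintegral_smul_measure, smul_eq_mul]
  congr 1
  have hv : ∀ v : sphere (0 : Space d) 1,
      ∫⁻ h : ℝ, g (x + h • (v : Space d)) ∂(displacement (gaussianWeight T K) x (v : Space d))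
        = ∫⁻ h : ℝ, F (h • (v : Space d)) := by
    intro v
    have hTv := hT v (ne_zero_of_mem_unit_sphere v)
    have hv1 : ‖(v : Space d)‖ = 1 := norm_eq_of_mem_sphere v
    rw [displacement, lintegral_smul_measure, lintegral_gaussianWeight_add_smul hK x hTv,
      lintegral_withDensity_eq_lintegral_mul _ (by fun_prop) (by fun_prop), smul_eq_mul,
      ← lintegral_const_mul _ (by fun_prop)]
    refine lintegral_congr_ae ?_
    filter_upwards [Measure.ae_ne volume (0 : ℝ)] with h hh
    -- `lineMass` is homogeneous of degree `-1` in the direction, so multiplying by the norm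
    -- recovers its value at the unit vector.
    have hmass : ‖h • (v : Space d)‖ * lineMass T K x (h • (v : Space d))
        = lineMass T K x (v : Space d) := by
      have hTv' := norm_pos_iff.2 hTv
      have hh' := abs_pos.2 hh
      have hp : perpSq (T x) (h • T v) = perpSq (T x) (T v) := by
        rw [perpSq, perpSq, inner_smul_right, norm_smul, Real.norm_eq_abs, div_pow, div_pow,
          mul_pow, mul_pow, sq_abs, mul_div_mul_left _ _ (pow_ne_zero 2 hh)]
      rw [lineMass, lineMass, map_smul, hp, norm_smul, norm_smul, hv1, Real.norm_eq_abs]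
      field_simp
    rw [hFdef]
    simp only [Pi.mul_apply]
    rw [hmass, ENNReal.ofReal_inv_of_pos (lineMass_pos hK x hTv)]
  simp_rw [hv]
  rw [lintegral_toSphere_lintegral_smul volume hF]
  congr 1
  rw [← lintegral_sub_right_eq_self _ x]
  have hx0 : ∀ᵐ y : Space d, y ≠ x := Measure.ae_ne volume x
  refine lintegral_congr_ae ?_
  filter_upwards [hx0] with y hy
  have hpos : 0 < ‖y - x‖ := norm_pos_iff.2 (sub_ne_zero.2 hy)
  simp only [hFdef, finrank_euclideanSpace, Fintype.card_fin, add_sub_cancel]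
  rw [ENNReal.ofReal_mul (by positivity), mul_assoc, ENNReal.ofReal_inv_of_pos (pow_pos hpos _)]

end

/-! ### Radial majorants and their means -/

/-- A radial bound for the logarithmic density ratio of two transition distributions. -/
noncomputable def radialBound (ε s c₀ c₁ c₂ n h : ℝ) : ℝ :=
  c₀ + (if |h| < ε then c₁ - n * Real.log h else 0) + if |h| < s then c₂ else 0

theorem measurable_radialBound (ε s c₀ c₁ c₂ n : ℝ) :
    Measurable (radialBound ε s c₀ c₁ c₂ n) := by
  have hm : ∀ t : ℝ, MeasurableSet {h : ℝ | |h| < t} := fun t =>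
    measurableSet_lt (by fun_prop) measurable_const
  exact (measurable_const.add
    (Measurable.ite (hm ε) (by fun_prop) measurable_const)).add
    (Measurable.ite (hm s) measurable_const measurable_const)

theorem neg_log_nonneg_of_abs_lt {ε h : ℝ} (hε : ε < 1) (hh : |h| < ε) : 0 ≤ -Real.log h := by
  rw [← Real.log_abs]
  exact neg_nonneg.2 (Real.log_nonpos (abs_nonneg h) (hh.trans hε).le)

theorem radialBound_nonneg {ε s c₀ c₁ c₂ n : ℝ} (hε : ε < 1) (h₀ : 0 ≤ c₀) (h₁ : 0 ≤ c₁)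
    (h₂ : 0 ≤ c₂) (hn : 0 ≤ n) (h : ℝ) : 0 ≤ radialBound ε s c₀ c₁ c₂ n h := by
  unfold radialBound
  refine add_nonneg (add_nonneg h₀ ?_) (by split_ifs <;> simp [h₂])
  split_ifs with hh
  · have := mul_nonneg hn (neg_log_nonneg_of_abs_lt hε hh)
    linarith
  · exact le_rfl

/-- The density bound `B / 2` gives `(-t, t)` mass at most `B t`, and `-log|h|` is integrable at
zero. -/
theorem lintegral_radialBound_le {μ : Measure ℝ} [IsProbabilityMeasure μ] {B : ℝ} (hB : 0 ≤ B)
    (hμ : μ ≤ ENNReal.ofReal (B / 2) • volume) {ε s c₀ c₁ c₂ n : ℝ} (hε0 : 0 < ε) (hε : ε < 1)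
    (hs : 0 ≤ s) (h₀ : 0 ≤ c₀) (h₁ : 0 ≤ c₁) (h₂ : 0 ≤ c₂) (hn : 0 ≤ n) :
    ∫⁻ h, ENNReal.ofReal (radialBound ε s c₀ c₁ c₂ n h) ∂μ
      ≤ ENNReal.ofReal (c₀ + B * ε * (c₁ + n * (1 - Real.log ε)) + B * s * c₂) := by
  have hset : ∀ t : ℝ, {h : ℝ | |h| < t} = Set.Ioo (-t) t := fun t => by
    ext h; simp [abs_lt]
  have hm : ∀ t : ℝ, MeasurableSet {h : ℝ | |h| < t} := fun t => by
    rw [hset]; exact measurableSet_Ioo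
  have hlog := Real.log_nonpos hε0.le hε.le
  have e1 : ∫⁻ h, ENNReal.ofReal (if |h| < ε then c₁ - n * Real.log h else 0) ∂μ
      ≤ ENNReal.ofReal (B * ε * (c₁ + n * (1 - Real.log ε))) := by
    have hint : IntervalIntegrable (fun h => c₁ - n * Real.log h) volume (-ε) ε :=
      intervalIntegrable_const.sub (intervalIntegral.intervalIntegrable_log'.const_mul n)
    -- `Real.log` is even, so both halves of the interval contribute `ε (1 - log ε)`.
    have hval : ∫ h in (-ε)..ε, (c₁ - n * Real.log h) = 2 * ε * (c₁ + n * (1 - Real.log ε)) := by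
      rw [intervalIntegral.integral_sub intervalIntegrable_const
        (intervalIntegral.intervalIntegrable_log'.const_mul n),
        intervalIntegral.integral_const_mul, integral_log, intervalIntegral.integral_const,
        Real.log_neg_eq_log, smul_eq_mul]
      ring
    calc ∫⁻ h, ENNReal.ofReal (if |h| < ε then c₁ - n * Real.log h else 0) ∂μ
        ≤ ENNReal.ofReal (B / 2) *
          ∫⁻ h, ENNReal.ofReal (if |h| < ε then c₁ - n * Real.log h else 0) := by
          refine (lintegral_mono' hμ le_rfl).trans_eq ?_
          rw [lintegral_smul_measure, smul_eq_mul]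
      _ = ENNReal.ofReal (B / 2) *
          ∫⁻ h in Set.Ioo (-ε) ε, ENNReal.ofReal (c₁ - n * Real.log h) := by
          rw [← lintegral_indicator measurableSet_Ioo]
          congr 1
          refine lintegral_congr fun h => ?_
          by_cases hh : |h| < ε
          · rw [if_pos hh, Set.indicator_of_mem (show h ∈ Set.Ioo (-ε) ε from abs_lt.1 hh)]
          · rw [if_neg hh, ENNReal.ofReal_zero,
              Set.indicator_of_notMem (show h ∉ Set.Ioo (-ε) ε from fun hc => hh (abs_lt.2 hc))]
      _ = ENNReal.ofReal (B / 2) * ENNReal.ofReal (2 * ε * (c₁ + n * (1 - Real.log ε))) := by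
          have hIoo : IntegrableOn (fun h => c₁ - n * Real.log h) (Set.Ioo (-ε) ε) :=
            ((intervalIntegrable_iff_integrableOn_Ioc_of_le (by linarith)).1 hint).mono_set
              Set.Ioo_subset_Ioc_self
          rw [← ofReal_integral_eq_lintegral_ofReal hIoo, ← integral_Ioc_eq_integral_Ioo,
            ← intervalIntegral.integral_of_le (by linarith), hval]
          refine (ae_restrict_iff' measurableSet_Ioo).2 (Filter.Eventually.of_forall fun h hh => ?_)
          have := mul_nonneg hn (neg_log_nonneg_of_abs_lt hε (abs_lt.2 hh))
          simp only [Pi.zero_apply]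
          linarith
      _ = _ := by
          rw [← ENNReal.ofReal_mul (by positivity)]
          congr 1; ring
  have e2 : ∫⁻ h, ENNReal.ofReal (if |h| < s then c₂ else 0) ∂μ ≤ ENNReal.ofReal (B * s * c₂) := by
    have : ∀ h : ℝ, ENNReal.ofReal (if |h| < s then c₂ else 0)
        = {h : ℝ | |h| < s}.indicator (fun _ => ENNReal.ofReal c₂) h := fun h => by
      by_cases hh : |h| < s <;> simp [hh]
    simp_rw [this]
    rw [lintegral_indicator_const (hm s)]
    calc ENNReal.ofReal c₂ * μ {h : ℝ | |h| < s}
        ≤ ENNReal.ofReal c₂ * (ENNReal.ofReal (B / 2) * ENNReal.ofReal (s - -s)) := by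
          gcongr
          refine (hμ _).trans_eq ?_
          rw [Measure.smul_apply, hset, Real.volume_Ioo, smul_eq_mul]
      _ = _ := by
          rw [← ENNReal.ofReal_mul (by positivity), ← ENNReal.ofReal_mul h₂]
          congr 1; ring
  calc ∫⁻ h, ENNReal.ofReal (radialBound ε s c₀ c₁ c₂ n h) ∂μ
      ≤ ∫⁻ h, (ENNReal.ofReal c₀ + ENNReal.ofReal (if |h| < ε then c₁ - n * Real.log h else 0)
          + ENNReal.ofReal (if |h| < s then c₂ else 0)) ∂μ :=
        lintegral_mono fun h =>
          ENNReal.ofReal_add_le.trans (add_le_add_left ENNReal.ofReal_add_le _)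
    _ ≤ ENNReal.ofReal c₀ + ENNReal.ofReal (B * ε * (c₁ + n * (1 - Real.log ε)))
          + ENNReal.ofReal (B * s * c₂) := by
        have hm1 : Measurable (fun h : ℝ =>
            ENNReal.ofReal (if |h| < ε then c₁ - n * Real.log h else 0)) :=
          (Measurable.ite (hm ε) (by fun_prop) measurable_const).ennreal_ofReal
        rw [lintegral_add_left (by fun_prop), lintegral_add_left measurable_const,
          lintegral_const, measure_univ, mul_one]
        gcongr
    _ = _ := by
        have : 0 ≤ B * ε * (c₁ + n * (1 - Real.log ε)) := by
          have : 0 ≤ 1 - Real.log ε := by linarith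
          positivity
        rw [ENNReal.ofReal_add (by positivity) (by positivity), ENNReal.ofReal_add h₀ this]

/-! ### Pointwise bound for the density ratio -/

section
variable {d : ℕ} {T : Space d →ₗ[ℝ] Space d} {M m ε : ℝ}

/-- The ratio of the radial parts of the densities, away from the starting point. -/
theorem norm_ratio_le_exp {E : Type*} [NormedAddCommGroup E] {z z' : E} {δ : ℝ}
    (hz : 0 < ‖z‖) (hzz : ‖z' - z‖ ≤ δ) (hε : 0 < ε) (hεz : ε ≤ ‖z‖) :
    ‖z'‖ / ‖z‖ ≤ Real.exp (δ / ε) := by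
  have h1 : ‖z'‖ ≤ ‖z‖ + δ := by
    have := norm_add_le z (z' - z)
    rw [add_sub_cancel] at this
    linarith
  have hδ : 0 ≤ δ := (norm_nonneg _).trans hzz
  calc ‖z'‖ / ‖z‖ ≤ (‖z‖ + δ) / ‖z‖ := by gcongr
    _ = δ / ‖z‖ + 1 := by field_simp; ring
    _ ≤ δ / ε + 1 := by gcongr
    _ ≤ _ := Real.add_one_le_exp _

/-- For `‖z‖ < 1` the numerator is at most `1 + δ ≤ exp δ`, leaving only a logarithmic singularity
in the exponent. -/
theorem norm_ratio_le_exp_of_lt {E : Type*} [NormedAddCommGroup E] {z z' : E} {δ : ℝ}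
    (hz : 0 < ‖z‖) (hzz : ‖z' - z‖ ≤ δ) (hz1 : ‖z‖ < 1) :
    ‖z'‖ / ‖z‖ ≤ Real.exp (δ - Real.log ‖z‖) := by
  have h1 : ‖z'‖ ≤ ‖z‖ + δ := by
    have := norm_add_le z (z' - z)
    rw [add_sub_cancel] at this
    linarith
  rw [Real.exp_sub, Real.exp_log hz]
  gcongr
  linarith [Real.add_one_le_exp δ]

/-- The ratio of the anisotropic parts of the densities. -/
theorem norm_map_ratio_le_exp (hm : 0 < m) (hmT : ∀ v, √m * ‖v‖ ≤ ‖T v‖)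
    (hMT : ∀ v, ‖T v‖ ≤ √M * ‖v‖) {z z' : Space d} (hz : 0 < ‖z‖) (hz' : 0 < ‖z'‖) :
    ‖T z‖ / ‖z‖ * (‖z'‖ / ‖T z'‖) ≤ Real.exp (√M + (√m)⁻¹) := by
  have hsm := Real.sqrt_pos.2 hm
  have hTz' : 0 < ‖T z'‖ := (by positivity : 0 < √m * ‖z'‖).trans_le (hmT z')
  have h1 : ‖T z‖ / ‖z‖ ≤ √M := by rw [div_le_iff₀ hz]; exact hMT z
  have h2 : ‖z'‖ / ‖T z'‖ ≤ (√m)⁻¹ := by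
    rw [div_le_iff₀ hTz', inv_mul_eq_div, le_div_iff₀ hsm, mul_comm]; exact hmT z'
  rw [Real.exp_add]
  -- Crude use of `t ≤ exp t` on each factor; hence the term `√M + (√m)⁻¹` in the constants.
  have h3 := Real.add_one_le_exp (√M)
  have h4 := Real.add_one_le_exp ((√m)⁻¹)
  calc _ ≤ √M * (√m)⁻¹ := by gcongr
    _ ≤ _ := by gcongr <;> linarith

/-- Regrouped as `‖z'‖ / ‖z‖` times `‖T z‖ / ‖T z'‖`, the ratio is near one. The threshold `ε + δ`,
rather than `ε`, keeps `z'` at distance at least `ε` from zero as well. -/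
theorem norm_map_ratio_le_exp_of_le (hm : 0 < m) (hmT : ∀ v, √m * ‖v‖ ≤ ‖T v‖) (hε : 0 < ε)
    {z z' : Space d} (hz : ε + ‖T (z' - z)‖ / √m ≤ ‖z‖) :
    ‖T z‖ / ‖z‖ * (‖z'‖ / ‖T z'‖) ≤ Real.exp (2 * (‖T (z' - z)‖ / √m / ε)) := by
  have hsm := Real.sqrt_pos.2 hm
  set δ := ‖T (z' - z)‖ / √m with hδ
  have hδ0 : 0 ≤ δ := by positivity
  have hzz : ‖z' - z‖ ≤ δ := by
    rw [hδ, le_div_iff₀ hsm, mul_comm]; exact hmT _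
  have hz0 : 0 < ‖z‖ := by linarith
  have hz' : ε ≤ ‖z'‖ := by
    have := norm_sub_norm_le z z'
    rw [norm_sub_rev] at this
    linarith
  have hTz' : √m * ε ≤ ‖T z'‖ := le_trans (by gcongr) (hmT z')
  have hTz'0 : 0 < ‖T z'‖ := (by positivity : 0 < √m * ε).trans_le hTz'
  have h1 : ‖z'‖ / ‖z‖ ≤ Real.exp (δ / ε) := norm_ratio_le_exp hz0 hzz hε (by linarith)
  have h2 : ‖T z‖ / ‖T z'‖ ≤ Real.exp (δ / ε) := by
    have h := norm_ratio_le_exp (z := T z') (z' := T z) (δ := ‖T (z' - z)‖) hTz'0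
      (by rw [← map_sub, ← neg_sub, map_neg, norm_neg]) (by positivity) hTz'
    rwa [← div_div] at h
  calc ‖T z‖ / ‖z‖ * (‖z'‖ / ‖T z'‖) = ‖z'‖ / ‖z‖ * (‖T z‖ / ‖T z'‖) := by ring
    _ ≤ Real.exp (δ / ε) * Real.exp (δ / ε) := by gcongr
    _ = _ := by rw [← Real.exp_add, two_mul]

/-- The radial function that bounds the logarithmic density ratio. -/
noncomputable def densityBound (M m ε r D n : ℝ) : ℝ → ℝ :=
  radialBound ε (ε + D / √m)
    (r ^ 2 * (D / √m) / ε + r * D + n * (D / √m / ε) + 2 * (D / √m / ε))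
    (r ^ 2 / 2 + n * (D / √m)) (√M + (√m)⁻¹) n

theorem log_density_ratio_le (hm : 0 < m) (hmT : ∀ v, √m * ‖v‖ ≤ ‖T v‖)
    (hMT : ∀ v, ‖T v‖ ≤ √M * ‖v‖) (hε0 : 0 < ε) (hε1 : ε < 1) (n : ℕ) {x x' y : Space d}
    (hy : y ≠ x) (hy' : y ≠ x') :
    (‖y - x'‖ / ‖y - x‖) ^ n *
      (‖T (y - x)‖ / ‖y - x‖ * (‖y - x'‖ / ‖T (y - x')‖)) *
      Real.exp ((perpSq (T x) (T (y - x)) - perpSq (T x') (T (y - x'))) / 2)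
    ≤ Real.exp (densityBound M m ε ‖T x‖ ‖T (x - x')‖ n ‖y - x‖) := by
  have hsm := Real.sqrt_pos.2 hm
  have hz : 0 < ‖y - x‖ := norm_pos_iff.2 (sub_ne_zero.2 hy)
  have hz' : 0 < ‖y - x'‖ := norm_pos_iff.2 (sub_ne_zero.2 hy')
  have hTz : 0 < ‖T (y - x)‖ := (by positivity : 0 < √m * ‖y - x‖).trans_le (hmT _)
  have hTz' : 0 < ‖T (y - x')‖ := (by positivity : 0 < √m * ‖y - x'‖).trans_le (hmT _)
  set r := ‖T x‖ with hr
  set D := ‖T (x - x')‖ with hD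
  have hD0 : 0 ≤ D := norm_nonneg _
  have hr0 : 0 ≤ r := norm_nonneg _
  set δ := D / √m with hδ
  have hδ0 : 0 ≤ δ := by positivity
  have hdiff : y - x' - (y - x) = x - x' := by abel
  have hzz : ‖y - x' - (y - x)‖ ≤ δ := by
    rw [hdiff, hδ, le_div_iff₀ hsm, mul_comm]; exact hmT _
  have hA : (‖y - x'‖ / ‖y - x‖) ^ n ≤ Real.exp (n * (δ / ε) +
      if |‖y - x‖| < ε then n * δ - n * Real.log ‖y - x‖ else 0) := by
    rw [abs_of_pos hz]
    split_ifs with h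
    · refine (pow_le_pow_left₀ (by positivity)
        (norm_ratio_le_exp_of_lt hz hzz (h.trans hε1)) n).trans ?_
      rw [← Real.exp_nat_mul]
      refine Real.exp_le_exp.2 ?_
      have : 0 ≤ n * (δ / ε) := by positivity
      linarith [mul_sub (n : ℝ) δ (Real.log ‖y - x‖)]
    · refine (pow_le_pow_left₀ (by positivity)
        (norm_ratio_le_exp hz hzz hε0 (not_lt.1 h)) n).trans ?_
      rw [← Real.exp_nat_mul, add_zero]
  have hB : ‖T (y - x)‖ / ‖y - x‖ * (‖y - x'‖ / ‖T (y - x')‖)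
      ≤ Real.exp (2 * (δ / ε) + if |‖y - x‖| < ε + δ then √M + (√m)⁻¹ else 0) := by
    rw [abs_of_pos hz]
    split_ifs with h
    · refine (norm_map_ratio_le_exp hm hmT hMT hz hz').trans (Real.exp_le_exp.2 ?_)
      have : 0 ≤ 2 * (δ / ε) := by positivity
      linarith
    · have := norm_map_ratio_le_exp_of_le (z := y - x) (z' := y - x') hm hmT hε0
        (by rw [hdiff]; exact not_lt.1 h)
      rwa [hdiff, ← hD, ← hδ, ← add_zero (2 * _)] at this
  -- Near `x` the first squared distance is at most `r ^ 2` and the second is dropped; elsewhere the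
  -- Lipschitz comparison of lines through `T y` applies.
  have hE : (perpSq (T x) (T (y - x)) - perpSq (T x') (T (y - x'))) / 2
      ≤ r ^ 2 * δ / ε + r * D + if |‖y - x‖| < ε then r ^ 2 / 2 else 0 := by
    rw [abs_of_pos hz]
    split_ifs with h
    · have h1 := perpSq_le (T x) (T (y - x))
      have h2 := perpSq_nonneg (T x') (T (y - x'))
      have : 0 ≤ r ^ 2 * δ / ε + r * D := by positivity
      linarith
    · have h1 : T y ≠ T x := fun h => by simp [map_sub, h] at hTz
      have h2 : T y ≠ T x' := fun h => by simp [map_sub, h] at hTz'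
      have h3 := perpSq_sub_perpSq_le h1 h2
      simp only [← map_sub, ← hr, ← hD] at h3
      have h4 : r ^ 2 * D / ‖T (y - x)‖ ≤ r ^ 2 * δ / ε := by
        have : √m * ε ≤ ‖T (y - x)‖ := le_trans (by gcongr; exact not_lt.1 h) (hmT _)
        calc r ^ 2 * D / ‖T (y - x)‖ ≤ r ^ 2 * D / (√m * ε) := by gcongr
          _ = _ := by rw [hδ]; field_simp
      linarith
  calc _ ≤ _ * _ * _ := by
        refine mul_le_mul (mul_le_mul hA hB (by positivity) (Real.exp_pos _).le)
          (Real.exp_le_exp.2 hE) (Real.exp_pos _).le (by positivity)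
    _ = _ := by
        rw [← Real.exp_add, ← Real.exp_add, densityBound, radialBound]
        congr 1
        split_ifs <;> ring

end

/-! ### Relative entropy -/

section
variable {d : ℕ} {T : Space d →ₗ[ℝ] Space d} {K M m ε : ℝ}

/-- A bound for the relative entropy of `π(x, ·)` with respect to `π(x', ·)`. -/
noncomputable def entropyBound (M m ε r D n : ℝ) : ℝ :=
  (r ^ 2 * (D / √m) / ε + r * D + n * (D / √m / ε) + 2 * (D / √m / ε))
    + √M * ε * ((r ^ 2 / 2 + n * (D / √m)) + n * (1 - Real.log ε))
    + √M * (ε + D / √m) * (√M + (√m)⁻¹)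

/-- Both kernels have explicit densities in which the target density at `y` and the sphere constant
coincide and cancel, so the pointwise ratio bound suffices. -/
theorem withDensity_hitAndRun_gaussianWeight_le (hd : 1 ≤ d) (hK : 0 < K) (hm : 0 < m)
    (hmT : ∀ v, √m * ‖v‖ ≤ ‖T v‖) (hMT : ∀ v, ‖T v‖ ≤ √M * ‖v‖) (hε0 : 0 < ε) (hε1 : ε < 1)
    (x x' : Space d) :
    (hitAndRun (gaussianWeight T K) x).withDensity (fun y => ENNReal.ofReal
        (Real.exp (-densityBound M m ε ‖T x‖ ‖T (x - x')‖ ((d - 1 : ℕ) : ℝ) ‖y - x‖)))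
      ≤ hitAndRun (gaussianWeight T K) x' := by
  have : Nonempty (Fin d) := ⟨⟨0, hd⟩⟩
  have hsm := Real.sqrt_pos.2 hm
  have hT : ∀ v, v ≠ 0 → T v ≠ 0 := fun v hv => by
    have := norm_pos_iff.2 hv
    exact norm_pos_iff.1 ((by positivity : 0 < √m * ‖v‖).trans_le (hmT v))
  have hW : Measurable fun y : Space d =>
      -densityBound M m ε ‖T x‖ ‖T (x - x')‖ ((d - 1 : ℕ) : ℝ) ‖y - x‖ :=
    ((measurable_radialBound _ _ _ _ _ _).comp (by fun_prop)).neg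
  refine Measure.le_iff.2 fun A hA => ?_
  have hind : Measurable (A.indicator (1 : Space d → ℝ≥0∞)) := measurable_one.indicator hA
  rw [withDensity_apply _ hA, ← lintegral_indicator hA, ← lintegral_indicator_one hA,
    lintegral_hitAndRun_gaussianWeight hT hd hK x (hW.exp.ennreal_ofReal.indicator hA),
    lintegral_hitAndRun_gaussianWeight hT hd hK x' hind]
  refine mul_le_mul_right (mul_le_mul_right (lintegral_mono_ae ?_) _) _
  have h1 : ∀ᵐ y : Space d, y ≠ x := Measure.ae_ne volume x
  have h2 : ∀ᵐ y : Space d, y ≠ x' := Measure.ae_ne volume x'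
  filter_upwards [h1, h2] with y hy hy'
  by_cases hyA : y ∈ A
  swap
  · simp [hyA]
  have hz : 0 < ‖y - x‖ := norm_pos_iff.2 (sub_ne_zero.2 hy)
  have hz' : 0 < ‖y - x'‖ := norm_pos_iff.2 (sub_ne_zero.2 hy')
  have hTz := norm_pos_iff.2 (hT _ (sub_ne_zero.2 hy))
  have hTz' := norm_pos_iff.2 (hT _ (sub_ne_zero.2 hy'))
  rw [Set.indicator_of_mem hyA, Set.indicator_of_mem hyA, Pi.one_apply, mul_one,
    mul_comm (gaussianWeight T K y), ← mul_assoc,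
    ← ENNReal.ofReal_mul (by unfold lineMass; positivity)]
  refine mul_le_mul_left (ENNReal.ofReal_le_ofReal ?_) _
  have key := log_density_ratio_le hm hmT hMT hε0 hε1 (d - 1) hy hy'
  rw [Real.exp_neg, ← div_eq_mul_inv, div_le_iff₀ (Real.exp_pos _)]
  refine le_trans (le_of_eq ?_) (mul_le_mul_of_nonneg_left key
    (by unfold lineMass; positivity))
  have hp : √(2 * Real.pi) ≠ 0 := by positivity
  rw [lineMass, lineMass, show (perpSq (T x) (T (y - x)) - perpSq (T x') (T (y - x'))) / 2
    = -perpSq (T x') (T (y - x')) / 2 - -perpSq (T x) (T (y - x)) / 2 by ring, Real.exp_sub, div_pow]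
  field_simp

theorem lintegral_densityBound_le (hd : 1 ≤ d) (hK : 0 < K) (hm : 0 < m)
    (hmT : ∀ v, √m * ‖v‖ ≤ ‖T v‖) (hMT : ∀ v, ‖T v‖ ≤ √M * ‖v‖) (hε0 : 0 < ε) (hε1 : ε < 1)
    (x : Space d) {r D n : ℝ} (hr : 0 ≤ r) (hD : 0 ≤ D) (hn : 0 ≤ n) :
    ∫⁻ y, ENNReal.ofReal (densityBound M m ε r D n ‖y - x‖)
        ∂hitAndRun (gaussianWeight T K) x ≤ ENNReal.ofReal (entropyBound M m ε r D n) := by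
  have := isProbabilityMeasure_unifSphere hd
  have hsm := Real.sqrt_pos.2 hm
  have hΦ : Measurable (densityBound M m ε r D n) := measurable_radialBound _ _ _ _ _ _
  rw [lintegral_hitAndRun (measurable_gaussianWeight T K) x (by fun_prop)]
  calc _ ≤ ∫⁻ _ : sphere (0 : Space d) 1,
        ENNReal.ofReal (entropyBound M m ε r D n) ∂unifSphere d := ?_
    _ = _ := by rw [lintegral_const, measure_univ, mul_one]
  refine lintegral_mono fun v => ?_
  have hv1 : ‖(v : Space d)‖ = 1 := norm_eq_of_mem_sphere v
  have hTv : T (v : Space d) ≠ 0 := norm_pos_iff.1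
    ((by rw [hv1]; positivity : 0 < √m * ‖(v : Space d)‖).trans_le (hmT v))
  have hμ : displacement (gaussianWeight T K) x (v : Space d)
      ≤ ENNReal.ofReal (√M / 2) • volume := by
    refine (displacement_gaussianWeight_le hK x hTv).trans ?_
    refine Measure.le_iff.2 fun A _ => ?_
    rw [Measure.smul_apply, Measure.smul_apply, smul_eq_mul, smul_eq_mul]
    have h1 := hMT v
    rw [hv1, mul_one] at h1
    gcongr
  have : IsProbabilityMeasure (displacement (gaussianWeight T K) x (v : Space d)) := by
    rw [displacement_gaussianWeight hK x hTv]; infer_instance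
  -- The majorant sees `h` only through `|h|`, so the estimate is one-dimensional and uniform in
  -- `v`.
  have hnorm : ∀ h : ℝ, densityBound M m ε r D n ‖x + h • (v : Space d) - x‖
      = densityBound M m ε r D n h := fun h => by
    rw [add_sub_cancel_left, norm_smul, hv1, mul_one, Real.norm_eq_abs, densityBound, radialBound,
      radialBound, abs_abs, Real.log_abs]
  simp_rw [hnorm]
  exact lintegral_radialBound_le (Real.sqrt_nonneg M) hμ hε0 hε1 (by positivity) (by positivity)
    (by positivity) (by positivity) hn

theorem abs_hitAndRun_gaussianWeight_sub_le (hd : 1 ≤ d) (hK : 0 < K) (hm : 0 < m)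
    (hmT : ∀ v, √m * ‖v‖ ≤ ‖T v‖) (hMT : ∀ v, ‖T v‖ ≤ √M * ‖v‖) (hε0 : 0 < ε) (hε1 : ε < 1)
    (x x' : Space d) {A : Set (Space d)} (hA : MeasurableSet A) :
    |(hitAndRun (gaussianWeight T K) x).real A - (hitAndRun (gaussianWeight T K) x').real A|
      ≤ √(entropyBound M m ε ‖T x‖ ‖T (x - x')‖ ((d - 1 : ℕ) : ℝ) / 2) := by
  have hsm := Real.sqrt_pos.2 hm
  have hT : ∀ v, v ≠ 0 → T v ≠ 0 := fun v hv => by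
    have := norm_pos_iff.2 hv
    exact norm_pos_iff.1 ((by positivity : 0 < √m * ‖v‖).trans_le (hmT v))
  have := isProbabilityMeasure_hitAndRun_gaussianWeight hT hd hK x
  have := isProbabilityMeasure_hitAndRun_gaussianWeight hT hd hK x'
  have hlog := Real.log_nonpos hε0.le hε1.le
  have h1 : 0 ≤ 1 - Real.log ε := by linarith
  set W : Space d → ℝ := fun y =>
    densityBound M m ε ‖T x‖ ‖T (x - x')‖ ((d - 1 : ℕ) : ℝ) ‖y - x‖
  have hWm : Measurable W := (measurable_radialBound _ _ _ _ _ _).comp (by fun_prop)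
  have hW0 : ∀ y, 0 ≤ W y := fun y => radialBound_nonneg hε1 (by positivity) (by positivity)
    (by positivity) (by positivity) _
  have hlin := lintegral_densityBound_le hd hK hm hmT hMT hε0 hε1 x (norm_nonneg (T x))
    (norm_nonneg (T (x - x'))) (Nat.cast_nonneg (d - 1))
  have hint : Integrable W (hitAndRun (gaussianWeight T K) x) :=
    ⟨hWm.aestronglyMeasurable, (hasFiniteIntegral_iff_ofReal
      (Filter.Eventually.of_forall hW0)).2 (hlin.trans_lt ENNReal.ofReal_lt_top)⟩
  rw [← ofReal_integral_eq_lintegral_ofReal hint (Filter.Eventually.of_forall hW0),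
    ENNReal.ofReal_le_ofReal_iff (by unfold entropyBound; positivity)] at hlin
  exact abs_measureReal_sub_le_sqrt _ _ hWm hint hlin
    (withDensity_hitAndRun_gaussianWeight_le hd hK hm hmT hMT hε0 hε1 x x') hA

end

/-! ### Matching the constants -/

/-- The entropy bound in terms of the constants of the theorem. -/
theorem entropyBound_le {d : ℕ} (hd : 1 ≤ d) {M m ε r D : ℝ} (hm : 0 < m) (hM : 0 ≤ M)
    (hε0 : 0 < ε) (hε1 : ε < 1) (hr : 0 ≤ r) (hD : 0 ≤ D) :
    √(entropyBound M m ε r D ((d - 1 : ℕ) : ℝ)) ≤ √(const₁ M m ε r) * D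
      + √(const₂ d M m (M / m) ε r) * √D + const₃ d M m ε r * √ε := by
  have hsm := Real.sqrt_pos.2 hm
  have hlog := Real.log_nonpos hε0.le hε1.le
  have hl : 0 ≤ 1 + Real.log ε⁻¹ := by rw [Real.log_inv]; linarith
  have hn : ((d - 1 : ℕ) : ℝ) = (d : ℝ) - 1 := by rw [Nat.cast_sub hd, Nat.cast_one]
  have hn0 : (0 : ℝ) ≤ (d : ℝ) - 1 := by rw [← hn]; positivity
  have hM4 : M ^ (1 / 4 : ℝ) = √√M := by
    rw [Real.sqrt_eq_rpow, Real.sqrt_eq_rpow, ← Real.rpow_mul hM]; norm_num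
  rw [hn]
  set n := (d : ℝ) - 1 with hndef
  set a := √M with ha
  set b := (√m)⁻¹ with hb
  have ha0 : 0 ≤ a := Real.sqrt_nonneg _
  have hb0 : 0 ≤ b := by positivity
  have hκ : √(M / m) = a * b := by rw [Real.sqrt_div hM, div_eq_mul_inv]
  have hC2 : 0 ≤ const₂ d M m (M / m) ε r := by unfold const₂; positivity
  set q := √3 * √a * r with hq
  set s := √2 * √(1 + Real.log ε⁻¹) * √a * √n with hs
  set t := √2 * √a * √(a + b + 2) with ht
  have hC3 : const₃ d M m ε r = q + s + t := by
    rw [const₃, hM4]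
  have hq2 : q ^ 2 = 3 * a * r ^ 2 := by
    rw [hq, mul_pow, mul_pow, Real.sq_sqrt (by norm_num), Real.sq_sqrt ha0]
  have hs2 : s ^ 2 = 2 * (1 + Real.log ε⁻¹) * a * n := by
    rw [hs, mul_pow, mul_pow, mul_pow, Real.sq_sqrt (by norm_num), Real.sq_sqrt hl,
      Real.sq_sqrt ha0, Real.sq_sqrt hn0]
  have ht2 : t ^ 2 = 2 * a * (a + b + 2) := by
    rw [ht, mul_pow, mul_pow, Real.sq_sqrt (by norm_num), Real.sq_sqrt ha0,
      Real.sq_sqrt (by positivity)]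
  have hq0 : 0 ≤ q := by positivity
  have hs0 : 0 ≤ s := by positivity
  have ht0 : 0 ≤ t := by positivity
  -- Terms carrying `D` go into `const₂`, the others into the squares of the three summands of
  -- `const₃`; `p1` to `p8` are the slack.
  have hE : entropyBound M m ε r D n
      ≤ const₂ d M m (M / m) ε r * D + (q ^ 2 + s ^ 2 + t ^ 2) * ε := by
    rw [hq2, hs2, ht2, entropyBound, const₂, hκ, Real.log_inv, ← sub_eq_add_neg]
    simp only [div_eq_mul_inv, ← ha, ← hb, ← hndef]
    rw [Real.log_inv, ← sub_eq_add_neg] at hl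
    have p1 : 0 ≤ r ^ 2 * D * b * ε⁻¹ := by positivity
    have p2 : 0 ≤ r * D := by positivity
    have p3 : 0 ≤ a * b * D * n * ε := by positivity
    have p4 : 0 ≤ a * b * D := by positivity
    have p5 : 0 ≤ a * ε * r ^ 2 := by positivity
    have p6 : 0 ≤ a * ε * n * (1 - Real.log ε) := by positivity
    have p7 : 0 ≤ a * ε * (a + b) := by positivity
    have p8 : 0 ≤ a * ε := by positivity
    linear_combination p1 + p2 + p3 + 2 * p4 + (5 / 2) * p5 + p6 + p7 + 4 * p8
  have hX : 0 ≤ √(const₂ d M m (M / m) ε r) * √D := by positivity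
  have hY : 0 ≤ (q + s + t) * √ε := by positivity
  refine (Real.sqrt_le_iff.2 ⟨add_nonneg hX hY, ?_⟩).trans
    (b := √(const₂ d M m (M / m) ε r) * √D + (q + s + t) * √ε) ?_
  · refine hE.trans ?_
    have e1 : (√(const₂ d M m (M / m) ε r) * √D) ^ 2 = const₂ d M m (M / m) ε r * D := by
      rw [mul_pow, Real.sq_sqrt hC2, Real.sq_sqrt hD]
    have e2 : ((q + s + t) * √ε) ^ 2 = (q + s + t) ^ 2 * ε := by
      rw [mul_pow, Real.sq_sqrt hε0.le]
    rw [add_sq, e1, e2]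
    have : (q ^ 2 + s ^ 2 + t ^ 2) * ε ≤ (q + s + t) ^ 2 * ε := by
      gcongr
      rw [show (q + s + t) ^ 2 = q ^ 2 + s ^ 2 + t ^ 2 + 2 * (q * s + q * t + s * t) by ring]
      exact le_add_of_nonneg_right (by positivity)
    have h0 := mul_nonneg hX hY
    rw [mul_assoc 2]
    linarith
  -- The `const₁` term is pure slack: the other two already dominate.
  · rw [hC3]
    have : 0 ≤ √(const₁ M m ε r) * D := by positivity
    linarith

/-! ### Spectral bounds for `C⁻¹` -/

section
variable {d : ℕ}

theorem inner_toEuclideanLin_eq_covNorm_sq {C : Matrix (Fin d) (Fin d) ℝ} (hC : C.PosDef)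
    (x : Space d) : ⟪x, C⁻¹.toEuclideanLin x⟫ = covNorm C x ^ 2 := by
  have hnn : 0 ≤ C⁻¹ := Matrix.nonneg_iff_posSemidef.2 hC.inv.posSemidef
  have hS : (CFC.sqrt C⁻¹).PosSemidef := Matrix.nonneg_iff_posSemidef.1 (CFC.sqrt_nonneg _)
  have hsq : CFC.sqrt C⁻¹ * CFC.sqrt C⁻¹ = C⁻¹ := CFC.sqrt_mul_sqrt_self _ hnn
  rw [covNorm, ← real_inner_self_eq_norm_sq, ← LinearMap.adjoint_inner_right,
    ← Matrix.toEuclideanLin_conjTranspose_eq_adjoint, hS.isHermitian.eq]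
  congr 1
  rw [Matrix.toLpLin_apply, Matrix.toLpLin_apply, Matrix.toLpLin_apply,
    Matrix.mulVec_mulVec, hsq]

theorem inner_toEuclideanLin_eq_sum {A : Matrix (Fin d) (Fin d) ℝ} (hA : A.IsHermitian)
    (x : Space d) :
    ⟪x, A.toEuclideanLin x⟫ = ∑ i, hA.eigenvalues i * ⟪hA.eigenvectorBasis i, x⟫ ^ 2 := by
  rw [← hA.eigenvectorBasis.sum_inner_mul_inner]
  refine Finset.sum_congr rfl fun i _ => ?_
  have h : A.toEuclideanLin (hA.eigenvectorBasis i)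
      = hA.eigenvalues i • hA.eigenvectorBasis i := by
    rw [Matrix.toLpLin_apply, hA.mulVec_eigenvectorBasis]
    simp
  have hadj : ⟪hA.eigenvectorBasis i, A.toEuclideanLin x⟫
      = ⟪A.toEuclideanLin (hA.eigenvectorBasis i), x⟫ := by
    rw [← LinearMap.adjoint_inner_left, ← Matrix.toEuclideanLin_conjTranspose_eq_adjoint, hA.eq]
  rw [hadj, h, real_inner_smul_left, real_inner_comm x]
  ring

theorem hasEigenvalue_eigenvalues {A : Matrix (Fin d) (Fin d) ℝ} (hA : A.IsHermitian)
    (i : Fin d) : Module.End.HasEigenvalue (Matrix.toLin' A) (hA.eigenvalues i) := by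
  have hne : (hA.eigenvectorBasis i).ofLp ≠ 0 := fun h =>
    hA.eigenvectorBasis.orthonormal.ne_zero i (WithLp.ofLp_injective 2 h)
  refine Module.End.hasEigenvalue_of_hasEigenvector (x := (hA.eigenvectorBasis i).ofLp)
    ⟨Module.End.mem_eigenspace_iff.2 ?_, hne⟩
  rw [Matrix.toLin'_apply, hA.mulVec_eigenvectorBasis]

theorem pos_of_hasEigenvalue {A : Matrix (Fin d) (Fin d) ℝ} (hA : A.PosDef) {a : ℝ}
    (ha : Module.End.HasEigenvalue (Matrix.toLin' A) a) : 0 < a := by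
  obtain ⟨v, hv⟩ := ha.exists_hasEigenvector
  have h1 := hA.dotProduct_mulVec_pos hv.2
  rw [← Matrix.toLin'_apply, hv.apply_eq_smul, dotProduct_smul, smul_eq_mul] at h1
  have h2 : 0 ≤ star v ⬝ᵥ v := dotProduct_star_self_nonneg v
  exact pos_of_mul_pos_left h1 h2

/-- Rayleigh quotient bounds: in an eigenbasis `covNorm C x ^ 2` is a sum of squared coordinates
weighted by eigenvalues in `[m, M]`. -/
theorem covNorm_bounds {C : Matrix (Fin d) (Fin d) ℝ} (hC : C.PosDef) {M m : ℝ}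
    (hM : IsGreatest {a : ℝ | Module.End.HasEigenvalue (Matrix.toLin' C⁻¹) a} M)
    (hm : IsLeast {a : ℝ | Module.End.HasEigenvalue (Matrix.toLin' C⁻¹) a} m) (x : Space d) :
    √m * ‖x‖ ≤ covNorm C x ∧ covNorm C x ≤ √M * ‖x‖ := by
  have hA := hC.inv.isHermitian
  have hm0 : 0 < m := pos_of_hasEigenvalue hC.inv hm.1
  have hM0 : 0 < M := pos_of_hasEigenvalue hC.inv hM.1
  have hN : 0 ≤ covNorm C x := norm_nonneg _
  have hx : ‖x‖ ^ 2 = ∑ i, ⟪hA.eigenvectorBasis i, x⟫ ^ 2 := by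
    rw [← hA.eigenvectorBasis.sum_sq_norm_inner_right]
    simp
  have hsum := inner_toEuclideanLin_eq_sum hA x
  rw [inner_toEuclideanLin_eq_covNorm_sq hC] at hsum
  constructor
  · refine abs_le_of_sq_le_sq' ?_ hN |>.2
    rw [mul_pow, Real.sq_sqrt hm0.le, hsum, hx, Finset.mul_sum]
    exact Finset.sum_le_sum fun i _ =>
      mul_le_mul_of_nonneg_right (hm.2 (hasEigenvalue_eigenvalues hA i)) (sq_nonneg _)
  · refine abs_le_of_sq_le_sq' ?_ (by positivity) |>.2
    rw [mul_pow, Real.sq_sqrt hM0.le, hsum, hx, Finset.mul_sum]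
    exact Finset.sum_le_sum fun i _ =>
      mul_le_mul_of_nonneg_right (hM.2 (hasEigenvalue_eigenvalues hA i)) (sq_nonneg _)

theorem gaussianDensity_eq_gaussianWeight {C : Matrix (Fin d) (Fin d) ℝ} (hC : C.PosDef) :
    gaussianDensity C = gaussianWeight (CFC.sqrt C⁻¹).toEuclideanLin
      (√((2 * Real.pi) ^ d * C.det))⁻¹ := by
  ext x
  rw [gaussianDensity, inner_toEuclideanLin_eq_covNorm_sq hC]
  rfl

end

end HitAndRun

/-! ### The total variation bound -/

theorem lemma4 (d : ℕ) (hd : 1 ≤ d) (C : Matrix (Fin d) (Fin d) ℝ) (hC : C.PosDef)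
    (M m κ : ℝ)
    (hM : IsGreatest {a : ℝ | Module.End.HasEigenvalue (Matrix.toLin' C⁻¹) a} M)
    (hm : IsLeast {a : ℝ | Module.End.HasEigenvalue (Matrix.toLin' C⁻¹) a} m)
    (hκ : κ = M / m)
    (ε : ℝ) (hε : ε ∈ Set.Ioo (0 : ℝ) 1)
    (x x' : EuclideanSpace ℝ (Fin d)) :
    HitAndRun.tvDist
        (HitAndRun.hitAndRun (HitAndRun.gaussianDensity C) x)
        (HitAndRun.hitAndRun (HitAndRun.gaussianDensity C) x') ≤
      √2 * (√(HitAndRun.const₁ M m ε (HitAndRun.covNorm C x)) * HitAndRun.covNorm C (x - x')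
        + √(HitAndRun.const₂ d M m κ ε (HitAndRun.covNorm C x)) * √(HitAndRun.covNorm C (x - x'))
        + HitAndRun.const₃ d M m ε (HitAndRun.covNorm C x) * √ε) := by
  have hm0 : 0 < m := HitAndRun.pos_of_hasEigenvalue hC.inv hm.1
  have hM0 : 0 < M := HitAndRun.pos_of_hasEigenvalue hC.inv hM.1
  have hdet := hC.det_pos
  have hK : 0 < (√((2 * Real.pi) ^ d * C.det))⁻¹ := by positivity
  set E := HitAndRun.entropyBound M m ε (HitAndRun.covNorm C x) (HitAndRun.covNorm C (x - x'))
    ((d - 1 : ℕ) : ℝ)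
  have hA : ∀ A : {A : Set (EuclideanSpace ℝ (Fin d)) // MeasurableSet A},
      |(HitAndRun.hitAndRun (HitAndRun.gaussianDensity C) x).real A
        - (HitAndRun.hitAndRun (HitAndRun.gaussianDensity C) x').real A| ≤ √(E / 2) := fun A => by
    rw [HitAndRun.gaussianDensity_eq_gaussianWeight hC]
    exact HitAndRun.abs_hitAndRun_gaussianWeight_sub_le hd hK hm0
      (fun v => (HitAndRun.covNorm_bounds hC hM hm v).1)
      (fun v => (HitAndRun.covNorm_bounds hC hM hm v).2) hε.1 hε.2 x x' A.2
  have hE : 2 * √(E / 2) = √2 * √E := by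
    rw [Real.sqrt_div' _ zero_le_two]
    have h2 : √2 * √2 = 2 := Real.mul_self_sqrt zero_le_two
    have : √(2 : ℝ) ≠ 0 := by positivity
    field_simp
    rw [pow_two, h2, mul_comm]
  calc HitAndRun.tvDist _ _ ≤ 2 * √(E / 2) :=
        mul_le_mul_of_nonneg_left (Real.iSup_le hA (Real.sqrt_nonneg _)) zero_le_two
    _ = √2 * √E := hE
    _ ≤ _ := by
        rw [hκ]
        exact mul_le_mul_of_nonneg_left (HitAndRun.entropyBound_le hd hm0 hM0.le hε.1 hε.2
          (norm_nonneg _) (norm_nonneg _)) (Real.sqrt_nonneg _)
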